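/- Let $\mathcal{X}$ be a unital $C^*$-algebra, $\mathcal{M}$ a von Neumann algebra on a Hilbert space $\mathcal{H}$, and let $\mathrm{CP}(\mathcal{X},\mathcal{M})$ be the set of completely positive maps $\mathcal{X}\to B(\mathcal{H})$ with values in $\mathcal{M}$. Let $T\in\mathrm{CP}(\mathcal{X},\mathcal{M})$ and let $(\pi_T,\mathcal{K}_T,V_T)$ be a minimal Stinespring representation of $T$: $\pi_T$ is a $^*$-representation of $\mathcal{X}$ on the Hilbert space $\mathcal{K}_T$, $V_T\in B(\mathcal{H},\mathcal{K}_T)$, $T(X)=V_T^*\pi_T(X)V_T$ for all $X\in\mathcal{X}$, and $\mathcal{K}_T=\overline{\mathrm{span}}(\pi_T(\mathcal{X})V_T\mathcal{H})$. For $R\in\pi_T(\mathcal{X})'$ with $0\le R\le 1$ put $T_R(X)=V_T^*R\pi_T(X)V_T$, $X\in\mathcal{X}$. Let $\pi_T(\mathcal{X})^c\subseteq B(\mathcal{K}_T)$ (the $\mathcal{M}$-relative commutant of $\pi_T(\mathcal{X})$) be the $\sigma$-weak closure of the linear span of $$\{R\in\pi_T(\mathcal{X})' \mid 0\le R\le 1,\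 T_R\in\mathrm{CP}(\mathcal{X},\mathcal{M})\}.$$ Then $\pi_T(\mathcal{X})^c$ is a von Neumann algebra on $\mathcal{K}_T$. -/

import Mathlib

open scoped CStarAlgebra InnerProductSpace

/-- `CP(𝒳, ℳ)`: the completely positive maps from `𝒳` to `B(H)` whose values lie in the
von Neumann algebra `ℳ` on `H`. -/
def CPMapsInto (𝒳 : Type*) [CStarAlgebra 𝒳] [PartialOrder 𝒳] [StarOrderedRing 𝒳]
    {H : Type*} [NormedAddCommGroup H] [InnerProductSpace ℂ H] [CompleteSpace H]
    (ℳ : VonNeumannAlgebra H) : Set (𝒳 →CP (H →L[ℂ] H)) :=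
  {T | ∀ x, T x ∈ ℳ}

/-- `(π, K, V)` is a minimal Stinespring representation of `T`: `T x = V* π(x) V` for all `x`,
and `K` is the closed linear span of `π(𝒳) V H`. -/
structure IsMinimalStinespring {𝒳 : Type*} [CStarAlgebra 𝒳] [PartialOrder 𝒳] [StarOrderedRing 𝒳]
    {H : Type*} [NormedAddCommGroup H] [InnerProductSpace ℂ H] [CompleteSpace H]
    {K : Type*} [NormedAddCommGroup K] [InnerProductSpace ℂ K] [CompleteSpace K]
    (T : 𝒳 →CP (H →L[ℂ] H)) (π : 𝒳 →⋆ₐ[ℂ] (K →L[ℂ] K)) (V : H →L[ℂ] K) : Prop where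
  map_eq : ∀ x, T x = V.adjoint ∘L π x ∘L V
  dense_span :
    (Submodule.span ℂ {k : K | ∃ (x : 𝒳) (h : H), k = π x (V h)}).topologicalClosure = ⊤

/-- The σ-weak (ultraweak) topology on `B(K)`: the coarsest topology that makes all functionals
`A ↦ ∑ₙ ⟪ξₙ, A ηₙ⟫` with `∑ₙ ‖ξₙ‖² < ∞` and `∑ₙ ‖ηₙ‖² < ∞` (equivalently, all functionals
`A ↦ Tr(σ A)` with `σ` of trace class) continuous. -/
@[reducible] noncomputable def sigmaWeakTopology (K : Type*) [NormedAddCommGroup K] [InnerProductSpace ℂ K] :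
    TopologicalSpace (K →L[ℂ] K) :=
  ⨅ (ξ : ℕ → K) (η : ℕ → K) (_ : Summable fun n => ‖ξ n‖ ^ 2) (_ : Summable fun n => ‖η n‖ ^ 2),
    TopologicalSpace.induced (fun A : K →L[ℂ] K => ∑' n, ⟪ξ n, A (η n)⟫_ℂ) inferInstance

/-- The operators `R ∈ π(𝒳)'` with `0 ≤ R ≤ 1` such that the map `x ↦ V* R π(x) V` belongs to
`CP(𝒳, ℳ)`. -/
def relativeEffects {𝒳 : Type*} [CStarAlgebra 𝒳] [PartialOrder 𝒳] [StarOrderedRing 𝒳]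
    {H : Type*} [NormedAddCommGroup H] [InnerProductSpace ℂ H] [CompleteSpace H]
    {K : Type*} [NormedAddCommGroup K] [InnerProductSpace ℂ K] [CompleteSpace K]
    (ℳ : VonNeumannAlgebra H) (π : 𝒳 →⋆ₐ[ℂ] (K →L[ℂ] K)) (V : H →L[ℂ] K) :
    Set (K →L[ℂ] K) :=
  {R | R ∈ Set.centralizer (Set.range π) ∧ 0 ≤ R ∧ R ≤ 1 ∧
    ∃ T' ∈ CPMapsInto 𝒳 ℳ, ∀ x, T' x = V.adjoint ∘L R ∘L π x ∘L V}

/-- The `ℳ`-relative commutant `π(𝒳)ᶜ`: the σ-weak closure of the linear span of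
`relativeEffects ℳ π V`. -/
def relativeCommutant {𝒳 : Type*} [CStarAlgebra 𝒳] [PartialOrder 𝒳] [StarOrderedRing 𝒳]
    {H : Type*} [NormedAddCommGroup H] [InnerProductSpace ℂ H] [CompleteSpace H]
    {K : Type*} [NormedAddCommGroup K] [InnerProductSpace ℂ K] [CompleteSpace K]
    (ℳ : VonNeumannAlgebra H) (π : 𝒳 →⋆ₐ[ℂ] (K →L[ℂ] K)) (V : H →L[ℂ] K) :
    Set (K →L[ℂ] K) :=
  @closure _ (sigmaWeakTopology K)
    (Submodule.span ℂ (relativeEffects ℳ π V) : Set (K →L[ℂ] K))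

/-! The relative commutant equals the commutant of `π(𝒳)` together with all lifts to `K` of elements
of `ℳ'`. A unitary `u ∈ ℳ'` commutes with `T`, so `π x (V h) ↦ π x (V (u h))` preserves inner
products and extends to `K`. Comparing matrix coefficients on the dense span shows that `R ∈ π(𝒳)'`
commutes with the lifts iff every `V* R π(x) V` lies in `ℳ`
(`IsMinimalStinespring.mem_centralizer_iff`). For `R ≥ 0` complete positivity is automatic
(`stinespringCP`), so `relativeEffects` is the set of effects of this commutant, which is spanned by
its effects and σ-weakly closed. -/

/-! ### Positivity of matrices over a C⋆-algebra -/

/-- Compressing a self-adjoint element by its negative part gives a nonpositive element, which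
vanishes only if the element is nonnegative. -/
theorem IsSelfAdjoint.exists_conj_eq_neg_star_mul_self {B : Type*} [NonUnitalCStarAlgebra B]
    [PartialOrder B] [StarOrderedRing B] {a : B} (ha : IsSelfAdjoint a) :
    ∃ b c : B, star b * a * b = -(star c * c) ∧ (c = 0 → 0 ≤ a) := by
  have hb : star a⁻ = a⁻ := (CFC.negPart_nonneg a).isSelfAdjoint
  have hconj : star a⁻ * a * a⁻ = -(star a⁻ * a⁻ * a⁻) := by
    have h : a⁻ * (a⁺ - a⁻) = -(a⁻ * a⁻) := by
      rw [mul_sub, CFC.negPart_mul_posPart, zero_sub]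
    rw [CFC.posPart_sub_negPart a ha] at h
    rw [hb, h, neg_mul]
  obtain ⟨c, hc⟩ := CStarAlgebra.nonneg_iff_eq_star_mul_self.1
    (star_left_conjugate_nonneg (CFC.negPart_nonneg a) a⁻)
  refine ⟨a⁻, c, by rw [hconj, hc], fun h0 => ?_⟩
  rw [← CFC.negPart_eq_zero_iff a ha]
  rw [h0, mul_zero, hb] at hc
  -- Here `hc` says that the cube of `a⁻` vanishes; two uses of the C⋆-identity descend from the
  -- fourth power to `a⁻`.
  have h2 : a⁻ * a⁻ = 0 := by
    rw [← CStarRing.star_mul_self_eq_zero_iff, star_mul, hb, ← mul_assoc, hc, zero_mul]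
  rwa [← CStarRing.star_mul_self_eq_zero_iff, hb]

theorem exists_eq_star_mul_self_of_nonneg {B : Type*} [NonUnitalCStarAlgebra B]
    [PartialOrder B] [StarOrderedRing B] {a : B} (ha : 0 ≤ a) : ∃ b, a = star b * b :=
  CStarAlgebra.nonneg_iff_eq_star_mul_self.1 ha

/-- A self-adjoint matrix over a C⋆-algebra is nonnegative if all its compressions by columns
are. -/
theorem CStarMatrix.nonneg_of_forall_column {A n : Type*} [NonUnitalCStarAlgebra A] [PartialOrder A]
    [StarOrderedRing A] [Fintype n] {M : CStarMatrix n n A} (hM : IsSelfAdjoint M)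
    (h : ∀ v : n → A, 0 ≤ ∑ i, ∑ j, star (v i) * M i j * v j) : 0 ≤ M := by
  obtain ⟨b, c, hbc, hc⟩ := hM.exists_conj_eq_neg_star_mul_self
  refine hc (CStarMatrix.ext fun k l => ?_)
  -- Up to sign this is the compression of `M` by column `l` of `b`, hence both `≥ 0` and `≤ 0`.
  have hl : ∑ i, star (c i l) * c i l = 0 := by
    refine le_antisymm ?_ (Finset.sum_nonneg fun i _ => star_mul_self_nonneg _)
    have hent : (star b * M * b) l l = (-(star c * c)) l l := by rw [← hbc]
    simp only [CStarMatrix.mul_apply, CStarMatrix.neg_apply, CStarMatrix.star_apply,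
      Finset.sum_mul] at hent
    rw [Finset.sum_comm] at hent
    rw [← neg_nonneg, ← hent]
    exact h fun i => b i l
  exact (CStarRing.star_mul_self_eq_zero_iff _).1
    ((Finset.sum_eq_zero_iff_of_nonneg fun i _ => star_mul_self_nonneg (c i l)).1 hl k
      (Finset.mem_univ k))

theorem continuous_inner_sigmaWeakTopology {K : Type*} [NormedAddCommGroup K] [InnerProductSpace ℂ K]
    (ξ η : K) :
    @Continuous _ _ (sigmaWeakTopology K) _ fun A : K →L[ℂ] K => ⟪ξ, A η⟫_ℂ := by
  have hsum : ∀ ζ : K, Summable fun n : ℕ => ‖(Pi.single 0 ζ : ℕ → K) n‖ ^ 2 := fun ζ =>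
    summable_of_ne_finset_zero (s := {0}) fun n hn => by
      rw [Pi.single_eq_of_ne (by simpa using hn), norm_zero, zero_pow two_ne_zero]
  have heq : (fun A : K →L[ℂ] K => ⟪ξ, A η⟫_ℂ) = fun A : K →L[ℂ] K =>
      ∑' n, ⟪(Pi.single 0 ξ : ℕ → K) n, A ((Pi.single 0 η : ℕ → K) n)⟫_ℂ := by
    funext A
    rw [tsum_eq_single 0 fun n hn => by rw [Pi.single_eq_of_ne hn, inner_zero_left],
      Pi.single_eq_same, Pi.single_eq_same]
  rw [heq, continuous_iff_le_induced]
  exact iInf_le_of_le (Pi.single 0 ξ) <| iInf_le_of_le (Pi.single 0 η) <|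
    iInf_le_of_le (hsum ξ) <| iInf_le_of_le (hsum η) le_rfl

section

variable {𝒳 : Type*} [CStarAlgebra 𝒳]
  {H : Type*} [NormedAddCommGroup H] [InnerProductSpace ℂ H] [CompleteSpace H]
  {K : Type*} [NormedAddCommGroup K] [InnerProductSpace ℂ K] [CompleteSpace K]

/-! ### The commutant of `ℳ` and its lifts -/

/-- An operator lies in a von Neumann algebra as soon as it commutes with the unitaries of the
commutant. -/
theorem VonNeumannAlgebra.mem_of_commute_unitary (ℳ : VonNeumannAlgebra H) {a : H →L[ℂ] H}
    (h : ∀ u ∈ unitary (H →L[ℂ] H), u ∈ ℳ.commutant → u * a = a * u) : a ∈ ℳ := by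
  rw [← ℳ.commutant_commutant, VonNeumannAlgebra.mem_commutant_iff]
  intro b hb
  -- Norm closedness makes the commutant a C⋆-algebra, so its elements are combinations of four of
  -- its own unitaries.
  have hcl : IsClosed (ℳ.commutant.toStarSubalgebra : Set (H →L[ℂ] H)) := by
    rw [VonNeumannAlgebra.coe_toStarSubalgebra, VonNeumannAlgebra.coe_commutant]
    exact Set.isClosed_centralizer _
  obtain ⟨u, c, hbu, -⟩ := CStarAlgebra.exists_sum_four_unitary
    (⟨b, hb⟩ : ℳ.commutant.toStarSubalgebra)
  have hb' : b = ∑ i, c i • ((u i : ℳ.commutant.toStarSubalgebra) : H →L[ℂ] H) := by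
    simpa using congrArg (fun z : ℳ.commutant.toStarSubalgebra => (z : H →L[ℂ] H)) hbu
  rw [hb', Finset.sum_mul, Finset.mul_sum]
  refine Finset.sum_congr rfl fun i _ => ?_
  rw [smul_mul_assoc, mul_smul_comm, h _ _ (u i).1.2]
  have hu := Unitary.mem_iff.1 (u i).2
  exact Unitary.mem_iff.2 ⟨congrArg Subtype.val hu.1, congrArg Subtype.val hu.2⟩

/-- The operators on `K` that, together with their adjoints, implement on `π(𝒳) V H` the action
of an element of the commutant of `ℳ`. -/
def commutantLifts (ℳ : VonNeumannAlgebra H) (π : 𝒳 →⋆ₐ[ℂ] (K →L[ℂ] K)) (V : H →L[ℂ] K) :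
    Set (K →L[ℂ] K) :=
  {B | ∃ u ∈ ℳ.commutant, (∀ x h, B (π x (V h)) = π x (V (u h))) ∧
      ∀ x h, B.adjoint (π x (V h)) = π x (V (star u h))}

/-- Taking adjoints swaps the two conditions on a lift and replaces `u` by `star u`. Star-invariance
makes the commutant of this set a von Neumann algebra. -/
theorem star_union_commutantLifts (ℳ : VonNeumannAlgebra H) (π : 𝒳 →⋆ₐ[ℂ] (K →L[ℂ] K))
    (V : H →L[ℂ] K) :
    star (Set.range π ∪ commutantLifts ℳ π V) = Set.range π ∪ commutantLifts ℳ π V := by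
  have hsub : star (Set.range π ∪ commutantLifts ℳ π V) ⊆
      Set.range π ∪ commutantLifts ℳ π V := by
    rintro B (⟨x, hx⟩ | ⟨u, hu, h1, h2⟩)
    · exact .inl ⟨star x, by rw [map_star, hx, star_star]⟩
    · refine .inr ⟨star u, star_mem hu, fun x h => ?_, fun x h => ?_⟩
      · rw [← h2, ← ContinuousLinearMap.star_eq_adjoint, star_star]
      · rw [star_star]
        exact h1 x h
  refine hsub.antisymm fun B hB => Set.mem_star.2 (hsub ?_)
  rwa [Set.mem_star, star_star]

variable [PartialOrder 𝒳] [StarOrderedRing 𝒳]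

/-! ### Compressions and minimal Stinespring spaces -/

/-- `x ↦ V* R π(x) V` as a completely positive map, for `R ≥ 0` in the commutant of `π`. -/
noncomputable def stinespringCP (π : 𝒳 →⋆ₐ[ℂ] (K →L[ℂ] K)) (V : H →L[ℂ] K) (R : K →L[ℂ] K)
    (hR : R ∈ Set.centralizer (Set.range π)) (hR0 : 0 ≤ R) : 𝒳 →CP (H →L[ℂ] H) where
  toFun x := V.adjoint ∘L R ∘L π x ∘L V
  map_add' x y := by ext; simp
  map_smul' c x := by ext; simp
  map_cstarMatrix_nonneg' k M hM := by
    have hcomm : ∀ x, π x * R = R * π x := fun x => hR _ ⟨x, rfl⟩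
    refine CStarMatrix.nonneg_of_forall_column ?_ fun v => ?_
    · ext i j : 2
      have hMij : star (M j i) = M i j := CStarMatrix.star_apply_of_isSelfAdjoint hM.isSelfAdjoint
      have hRs : R.adjoint = R := hR0.isSelfAdjoint
      have hπ : (π (M j i)).adjoint = π (M i j) := by
        rw [← hMij, map_star]; rfl
      have := hcomm (M i j)
      simp only [ContinuousLinearMap.mul_def] at this
      simp only [CStarMatrix.star_apply, CStarMatrix.map_apply, LinearMap.coe_mk, AddHom.coe_mk,
        ContinuousLinearMap.star_eq_adjoint, ContinuousLinearMap.adjoint_comp,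
        ContinuousLinearMap.adjoint_adjoint, hRs, hπ, ContinuousLinearMap.comp_assoc]
      rw [← ContinuousLinearMap.comp_assoc (π _), this, ContinuousLinearMap.comp_assoc]
    · obtain ⟨N, rfl⟩ := exists_eq_star_mul_self_of_nonneg hM
      -- Factoring the matrix as `star N * N` and moving `R` past `π` leaves a sum of terms `W* R
      -- W`.
      have key : ∑ i, ∑ j, star (v i) * ((star N * N).map fun x => V.adjoint ∘L R ∘L π x ∘L V) i j *
            v j = ∑ l, (∑ i, π (N l i) ∘L V ∘L v i).adjoint ∘L R ∘L (∑ j, π (N l j) ∘L V ∘L v j) := by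
        have hπ : ∀ x, π (star x) = (π x).adjoint := fun x => map_star π x
        have hc : ∀ (x : 𝒳) (z : K), R (π x z) = π x (R z) := fun x z =>
          (DFunLike.congr_fun (hcomm x) z).symm
        have hcs : ∀ (x : 𝒳) (z : K), R ((π x).adjoint z) = (π x).adjoint (R z) := fun x z => by
          rw [← hπ, hc]
        ext z
        simp only [CStarMatrix.map_apply, CStarMatrix.mul_apply, CStarMatrix.star_apply, map_sum,
          map_mul, ContinuousLinearMap.mul_def, ContinuousLinearMap.adjoint_comp,
          ContinuousLinearMap.star_eq_adjoint, FunLike.coe_sum, Finset.sum_apply,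
          ContinuousLinearMap.comp_apply, hc, hcs, hπ]
        conv_rhs => rw [Finset.sum_comm]
        rw [Finset.sum_comm]
        exact Finset.sum_congr rfl fun i _ => Finset.sum_comm
      refine key ▸ Finset.sum_nonneg fun l _ => ?_
      rw [ContinuousLinearMap.nonneg_iff_isPositive] at hR0 ⊢
      exact hR0.adjoint_conj _

theorem IsMinimalStinespring.dense {T : 𝒳 →CP (H →L[ℂ] H)} {π : 𝒳 →⋆ₐ[ℂ] (K →L[ℂ] K)}
    {V : H →L[ℂ] K} (hπV : IsMinimalStinespring T π V) :
    Dense (Submodule.span ℂ {k : K | ∃ (x : 𝒳) (h : H), k = π x (V h)} : Set K) :=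
  Submodule.dense_iff_topologicalClosure_eq_top.2 hπV.dense_span

/-- The Gram matrix of the generating vectors depends only on `T`; this is why symmetries of `T`
lift. -/
theorem IsMinimalStinespring.inner_eq {T : 𝒳 →CP (H →L[ℂ] H)} {π : 𝒳 →⋆ₐ[ℂ] (K →L[ℂ] K)}
    {V : H →L[ℂ] K} (hπV : IsMinimalStinespring T π V) (x y : 𝒳) (h k : H) :
    ⟪π x (V h), π y (V k)⟫_ℂ = ⟪h, T (star x * y) k⟫_ℂ := by
  have hπ : π (star x) = (π x).adjoint := map_star π x
  rw [hπV.map_eq, map_mul, hπ]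
  simp [ContinuousLinearMap.adjoint_inner_right]

/-- A unitary commuting with the range of `T` acts on the right of `V` in the minimal Stinespring
space. -/
theorem IsMinimalStinespring.exists_comp_eq {T : 𝒳 →CP (H →L[ℂ] H)} {π : 𝒳 →⋆ₐ[ℂ] (K →L[ℂ] K)}
    {V : H →L[ℂ] K} (hπV : IsMinimalStinespring T π V) {u : H →L[ℂ] H}
    (hu : u ∈ unitary (H →L[ℂ] H)) (hc : ∀ x, u * T x = T x * u) :
    ∃ B : K →L[ℂ] K, ∀ x h, B (π x (V h)) = π x (V (u h)) := by
  -- Working with formal combinations avoids a separate check of well-definedness: `‖f c‖ ≤ ‖e c‖`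
  -- lets `f` factor through `e`.
  let e : (𝒳 × H →₀ ℂ) →ₗ[ℂ] K := Finsupp.linearCombination ℂ fun p => π p.1 (V p.2)
  let f : (𝒳 × H →₀ ℂ) →ₗ[ℂ] K := Finsupp.linearCombination ℂ fun p => π p.1 (V (u p.2))
  have he : DenseRange e := by
    have hr : Set.range e = Submodule.span ℂ {k : K | ∃ (x : 𝒳) (h : H), k = π x (V h)} := by
      rw [← LinearMap.coe_range, Finsupp.range_linearCombination]
      congr 2
      ext k
      simp [eq_comm]
    rw [DenseRange, hr]
    exact hπV.dense
  have hinner : ∀ (x y : 𝒳) (h k : H),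
      ⟪π x (V (u h)), π y (V (u k))⟫_ℂ = ⟪π x (V h), π y (V k)⟫_ℂ := fun x y h k => by
    have hT : T (star x * y) (u k) = u (T (star x * y) k) :=
      (DFunLike.congr_fun (hc (star x * y)) k).symm
    rw [hπV.inner_eq, hπV.inner_eq, hT]
    exact ContinuousLinearMap.inner_map_map_of_mem_unitary hu _ _
  have hnorm : ∀ c, ‖f c‖ ≤ 1 * ‖e c‖ := fun c => by
    have hfe : ⟪f c, f c⟫_ℂ = ⟪e c, e c⟫_ℂ := by
      simp only [f, e, Finsupp.linearCombination_apply, Finsupp.sum, sum_inner, inner_sum,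
        inner_smul_left, inner_smul_right, hinner]
    rw [inner_self_eq_norm_sq_to_K, inner_self_eq_norm_sq_to_K] at hfe
    rw [one_mul]
    refine le_of_eq ((sq_eq_sq₀ (norm_nonneg _) (norm_nonneg _)).1 ?_)
    exact_mod_cast hfe
  refine ⟨f.extendOfNorm e, fun x h => ?_⟩
  have := LinearMap.extendOfNorm_eq he ⟨1, hnorm⟩ (Finsupp.single (x, h) 1)
  simpa [e, f] using this

/-- A unitary commuting with the range of `T` lifts to the minimal Stinespring space, together
with its adjoint. -/
theorem IsMinimalStinespring.exists_lift {T : 𝒳 →CP (H →L[ℂ] H)} {π : 𝒳 →⋆ₐ[ℂ] (K →L[ℂ] K)}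
    {V : H →L[ℂ] K} (hπV : IsMinimalStinespring T π V) {u : H →L[ℂ] H}
    (hu : u ∈ unitary (H →L[ℂ] H)) (hc : ∀ x, u * T x = T x * u) :
    ∃ B : K →L[ℂ] K, (∀ x h, B (π x (V h)) = π x (V (u h))) ∧
      ∀ x h, B.adjoint (π x (V h)) = π x (V (star u h)) := by
  obtain ⟨B, hB⟩ := hπV.exists_comp_eq hu hc
  refine ⟨B, hB, fun x h => ?_⟩
  refine (innerSL_inj (𝕜 := ℂ)).1 ?_
  refine ContinuousLinearMap.ext_on hπV.dense ?_
  rintro _ ⟨y, k, rfl⟩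
  have hT : T (star x * y) (u k) = u (T (star x * y) k) :=
    (DFunLike.congr_fun (hc (star x * y)) k).symm
  rw [innerSL_apply_apply, innerSL_apply_apply, ContinuousLinearMap.adjoint_inner_left, hB,
    hπV.inner_eq, hπV.inner_eq, hT, ContinuousLinearMap.star_eq_adjoint,
    ContinuousLinearMap.adjoint_inner_left]

/-- The commutant of a star-closed set of operators. -/
noncomputable def VonNeumannAlgebra.ofStarEq (S : Set (K →L[ℂ] K)) (hS : star S = S) :
    VonNeumannAlgebra K where
  toStarSubalgebra := StarSubalgebra.centralizer ℂ S
  centralizer_centralizer' := by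
    have : (StarSubalgebra.centralizer ℂ S).carrier = S.centralizer := by
      change ((StarSubalgebra.centralizer ℂ S : StarSubalgebra ℂ (K →L[ℂ] K)) : Set (K →L[ℂ] K)) = _
      rw [StarSubalgebra.coe_centralizer, hS, Set.union_self]
    rw [this, Set.centralizer_centralizer_centralizer]

theorem VonNeumannAlgebra.coe_ofStarEq (S : Set (K →L[ℂ] K)) (hS : star S = S) :
    (VonNeumannAlgebra.ofStarEq S hS : Set (K →L[ℂ] K)) = S.centralizer := by
  change ((StarSubalgebra.centralizer ℂ S : StarSubalgebra ℂ (K →L[ℂ] K)) : Set (K →L[ℂ] K)) = _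
  rw [StarSubalgebra.coe_centralizer, hS, Set.union_self]

/-- An operator in the commutant of `π(𝒳)` commutes with all lifts from the commutant of `ℳ` iff
its compressions `V* R π(x) V` lie in `ℳ`. -/
theorem IsMinimalStinespring.mem_centralizer_iff {ℳ : VonNeumannAlgebra H}
    {T : 𝒳 →CP (H →L[ℂ] H)} (hT : T ∈ CPMapsInto 𝒳 ℳ) {π : 𝒳 →⋆ₐ[ℂ] (K →L[ℂ] K)}
    {V : H →L[ℂ] K} (hπV : IsMinimalStinespring T π V) {R : K →L[ℂ] K} :
    R ∈ (Set.range π ∪ commutantLifts ℳ π V).centralizer ↔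
      R ∈ (Set.range π).centralizer ∧ ∀ x, V.adjoint ∘L R ∘L π x ∘L V ∈ ℳ := by
  have hcomm : ∀ u ∈ ℳ.commutant, ∀ A ∈ ℳ, u * A = A * u := fun u hu A hA =>
    (VonNeumannAlgebra.mem_commutant_iff.1 hu A hA).symm
  constructor
  · intro hR
    refine ⟨fun B hB => hR B (.inl hB), fun x => ℳ.mem_of_commute_unitary fun u hu huc => ?_⟩
    obtain ⟨B, hB, hB'⟩ := hπV.exists_lift hu fun y => hcomm u huc _ (hT y)
    have hBR : ∀ z, B (R z) = R (B z) := DFunLike.congr_fun (hR B (.inr ⟨u, huc, hB, hB'⟩))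
    have hB1 : ∀ h, B.adjoint (V h) = V (star u h) := fun h => by
      simpa using hB' 1 h
    ext h
    refine ext_inner_left ℂ fun k => ?_
    simp only [mul_apply_eq_comp, ContinuousLinearMap.comp_apply]
    rw [← ContinuousLinearMap.adjoint_inner_left u, ContinuousLinearMap.adjoint_inner_right,
      ContinuousLinearMap.adjoint_inner_right, ← ContinuousLinearMap.star_eq_adjoint u, ← hB1,
      ContinuousLinearMap.adjoint_inner_left, hBR, hB]
  · rintro ⟨hR, hRM⟩ B (hB | ⟨u, hu, hB, hB'⟩)
    · exact hR B hB
    have hRπ : ∀ x z, π x (R z) = R (π x z) := fun x => DFunLike.congr_fun (hR _ ⟨x, rfl⟩)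
    -- Since `R` commutes with `π`, its coefficients on the generating vectors are those of its
    -- compressions.
    have hRinner : ∀ (x y : 𝒳) (h k : H), ⟪π y (V k), R (π x (V h))⟫_ℂ =
        ⟪k, (V.adjoint ∘L R ∘L π (star y * x) ∘L V) h⟫_ℂ := fun x y h k => by
      have hπ : π (star y) = (π y).adjoint := map_star π y
      simp only [ContinuousLinearMap.comp_apply, map_mul, mul_apply_eq_comp]
      rw [ContinuousLinearMap.adjoint_inner_right, ← hRπ (star y), hπ,
        ContinuousLinearMap.adjoint_inner_right]
    refine ContinuousLinearMap.ext_on hπV.dense ?_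
    rintro _ ⟨x, h, rfl⟩
    refine (innerSL_inj (𝕜 := ℂ)).1 ?_
    refine ContinuousLinearMap.ext_on hπV.dense ?_
    rintro _ ⟨y, k, rfl⟩
    rw [innerSL_apply_apply, innerSL_apply_apply, ← inner_conj_symm,
      ← inner_conj_symm _ (π y (V k))]
    congr 1
    rw [mul_apply_eq_comp, mul_apply_eq_comp,
      ← ContinuousLinearMap.adjoint_inner_left, hB, hB', hRinner, hRinner,
      ContinuousLinearMap.star_eq_adjoint, ContinuousLinearMap.adjoint_inner_left]
    exact congrArg _ (DFunLike.congr_fun (hcomm u hu _ (hRM (star y * x))) h)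

/-! ### σ-weak closedness and spanning by effects -/

/-- The commutant of a set of operators is σ-weakly closed. -/
theorem isClosed_sigmaWeakTopology_centralizer (S : Set (K →L[ℂ] K)) :
    @IsClosed _ (sigmaWeakTopology K) S.centralizer := by
  have hS : S.centralizer = ⋂ B ∈ S, ⋂ ξ : K, ⋂ η : K,
      {A : K →L[ℂ] K | ⟪B.adjoint ξ, A η⟫_ℂ = ⟪ξ, A (B η)⟫_ℂ} := by
    ext A
    simp only [Set.mem_iInter, Set.mem_ofPred_eq, Set.mem_centralizer_iff,
      ContinuousLinearMap.adjoint_inner_left]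
    refine forall₂_congr fun B _ => ⟨fun h ξ η => ?_, fun h => ?_⟩
    · exact congrArg _ (DFunLike.congr_fun h η)
    · ext η
      exact ext_inner_left ℂ fun ξ => h ξ η
  rw [hS]
  let := sigmaWeakTopology K
  exact isClosed_biInter fun B _ => isClosed_iInter fun ξ => isClosed_iInter fun η =>
    isClosed_eq (continuous_inner_sigmaWeakTopology _ _) (continuous_inner_sigmaWeakTopology _ _)

/-- A von Neumann algebra is spanned by its effects. -/
theorem VonNeumannAlgebra.mem_span_effects (N : VonNeumannAlgebra K) {a : K →L[ℂ] K}
    (ha : a ∈ N) : a ∈ Submodule.span ℂ {R : K →L[ℂ] K | R ∈ N ∧ 0 ≤ R ∧ R ≤ 1} := by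
  have hsmul : ∀ (c : ℂ) {b : K →L[ℂ] K}, b ∈ N → c • b ∈ N := fun c b hb =>
    N.toStarSubalgebra.smul_mem hb c
  have hsa : ∀ b : K →L[ℂ] K, b ∈ N → IsSelfAdjoint b →
      b ∈ Submodule.span ℂ {R : K →L[ℂ] K | R ∈ N ∧ 0 ≤ R ∧ R ≤ 1} := fun b hb hbs => by
    -- The `+ 1` keeps `r` invertible when `b = 0`; then `(b + r) / (2r)` is an effect.
    obtain ⟨r, hr⟩ : ∃ r : ℝ, r = ‖b‖ + 1 := ⟨_, rfl⟩
    have hr0 : 0 < r := hr ▸ by positivity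
    have hle : b ≤ algebraMap ℝ _ r := hbs.le_algebraMap_norm_self.trans
      (algebraMap_mono _ (by linarith))
    have hge : -algebraMap ℝ _ r ≤ b := le_trans (neg_le_neg (algebraMap_mono _ (by linarith)))
      hbs.neg_algebraMap_norm_le_self
    rw [Algebra.algebraMap_eq_smul_one] at hle hge
    have h1 : (1 : K →L[ℂ] K) ∈ Submodule.span ℂ {R : K →L[ℂ] K | R ∈ N ∧ 0 ≤ R ∧ R ≤ 1} :=
      Submodule.subset_span ⟨one_mem N, zero_le_one, le_rfl⟩
    have h2 : (2 * r)⁻¹ • (b + r • 1) ∈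
        Submodule.span ℂ {R : K →L[ℂ] K | R ∈ N ∧ 0 ≤ R ∧ R ≤ 1} := by
      refine Submodule.subset_span ⟨?_, ?_, ?_⟩
      · have := hsmul ((2 * r)⁻¹ : ℝ) (add_mem hb (hsmul (r : ℝ) (one_mem N)))
        simpa only [Complex.coe_smul] using this
      · exact smul_nonneg (by positivity) (by simpa using sub_nonneg.2 hge)
      · have h3 : b + r • 1 ≤ (2 * r) • (1 : K →L[ℂ] K) := by
          rw [two_mul, add_smul]
          exact add_le_add hle le_rfl
        calc (2 * r)⁻¹ • (b + r • 1) ≤ (2 * r)⁻¹ • (2 * r) • (1 : K →L[ℂ] K) :=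
              smul_le_smul_of_nonneg_left h3 (by positivity)
          _ = 1 := by rw [smul_smul, inv_mul_cancel₀ (by positivity), one_smul]
    have hb' : b = ((2 * r : ℝ) : ℂ) • ((2 * r)⁻¹ • (b + r • 1)) - (r : ℂ) • 1 := by
      rw [Complex.coe_smul, Complex.coe_smul, smul_smul, mul_inv_cancel₀ (by positivity), one_smul,
        add_sub_cancel_right]
    rw [hb']
    exact sub_mem (Submodule.smul_mem _ _ h2) (Submodule.smul_mem _ _ h1)
  have hre : ((realPart a : K →L[ℂ] K)) ∈ N := by
    rw [realPart_apply_coe, ← Complex.coe_smul]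
    exact hsmul _ (add_mem ha (star_mem ha))
  have him : ((imaginaryPart a : K →L[ℂ] K)) ∈ N := by
    rw [imaginaryPart_apply_coe, ← Complex.coe_smul]
    exact hsmul _ (hsmul _ (sub_mem ha (star_mem ha)))
  rw [← realPart_add_I_smul_imaginaryPart a]
  exact add_mem (hsa _ hre (realPart a).2) (Submodule.smul_mem _ _ (hsa _ him (imaginaryPart a).2))

end

theorem mainTheorem9 {𝒳 : Type*} [CStarAlgebra 𝒳] [PartialOrder 𝒳] [StarOrderedRing 𝒳]
    {H : Type*} [NormedAddCommGroup H] [InnerProductSpace ℂ H] [CompleteSpace H]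
    (ℳ : VonNeumannAlgebra H) (T : 𝒳 →CP (H →L[ℂ] H)) (hT : T ∈ CPMapsInto 𝒳 ℳ)
    {K : Type*} [NormedAddCommGroup K] [InnerProductSpace ℂ K] [CompleteSpace K]
    (π : 𝒳 →⋆ₐ[ℂ] (K →L[ℂ] K)) (V : H →L[ℂ] K) (hπV : IsMinimalStinespring T π V) :
    ∃ N : VonNeumannAlgebra K, (N : Set (K →L[ℂ] K)) = relativeCommutant ℳ π V := by
  set S := Set.range π ∪ commutantLifts ℳ π V with hS
  have hstar : star S = S := star_union_commutantLifts ℳ π V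
  have hmem : ∀ R, R ∈ VonNeumannAlgebra.ofStarEq S hstar ↔
      R ∈ (Set.range π).centralizer ∧ ∀ x, V.adjoint ∘L R ∘L π x ∘L V ∈ ℳ := fun R => by
    rw [← SetLike.mem_coe, VonNeumannAlgebra.coe_ofStarEq]
    exact hπV.mem_centralizer_iff hT
  have heff : relativeEffects ℳ π V =
      {R | R ∈ VonNeumannAlgebra.ofStarEq S hstar ∧ 0 ≤ R ∧ R ≤ 1} := by
    ext R
    rw [Set.mem_ofPred_eq, hmem]
    constructor
    · rintro ⟨hR, h0, h1, T', hT', hTR⟩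
      exact ⟨⟨hR, fun x => hTR x ▸ hT' x⟩, h0, h1⟩
    · rintro ⟨⟨hR, hM⟩, h0, h1⟩
      exact ⟨hR, h0, h1, stinespringCP π V R hR h0, hM, fun _ => rfl⟩
  refine ⟨VonNeumannAlgebra.ofStarEq S hstar, Set.Subset.antisymm ?_ ?_⟩
  · intro a ha
    refine @subset_closure _ (sigmaWeakTopology K) _ _ ?_
    rw [heff]
    exact VonNeumannAlgebra.mem_span_effects _ ha
  · refine @closure_minimal _ (sigmaWeakTopology K) _ _ ?_ ?_
    · rw [heff]
      exact Submodule.span_le (p := (VonNeumannAlgebra.ofStarEq S hstar).toSubalgebra.toSubmodule)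
        |>.2 fun R hR => hR.1
    · rw [VonNeumannAlgebra.coe_ofStarEq]
      exact isClosed_sigmaWeakTopology_centralizer S
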